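/- Let $\Gamma$ be a weighted digraph without loops on a vertex set $V$ with $n$ vertices; let $w_{ij}\ge 0$ be its arc weights ($w_{ij}>0$ if there is an arc from $i$ to $j$, and $w_{ij}=0$ otherwise). Let $L=(\ell_{ij})$ be its Laplacian matrix: $\ell_{ij}=-w_{ij}$ for $j\ne i$ and $\ell_{ii}=\sum_{k\ne i}w_{ik}$. A converging tree is a weakly connected digraph in which one vertex (the root) has outdegree $0$ and all other vertices have outdegree $1$. An in-forest of $\Gamma$ is a spanning subgraph of $\Gamma$ all of whose weak components are converging trees; its weight is the product of the weights of its arcs (and $1$ if it has no arcs). Let $d$ be the minimum possible number of trees in an in-forest of $\Gamma$. For $k=0,1,\dots$ let $\sigma_k$ be the total weight of all in-forests of $\Gamma$ with $k$ arcs, and let $Q_k$ be the $n\times n$ matrix whose $(i,j)$ entry is the total weight of the in-forests with $k$ arcs in which $i$ belongs to a tree with root $j$. Put $$J_k=\sigma_k^{-1}Q_k\ \ (0\le k\le n-d),\qquad \tilde J=J_{n-d},\qquad J(\tau)=\Bigl(\sum_{k=0}^{n-d}\sigma_k\tau^k\Bigr)^{-1}\sum_{k=0}^{n-d}Q_k\tau^k\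 \ (\tau\ge 0).$$ The group inverse $L^\#$ of $L$, i.e. the unique matrix $X$ with $LXL=L$, $XLX=X$ and $LX=XL$, exists, $\tilde J=I-LL^\#$, and the following holds, with scalars $\alpha$ in $\mathbb R$ or in $\mathbb C$. (i) For every $\alpha\ne 0$ the matrix $L+\alpha\tilde J$ is invertible and $L^\#=(L+\alpha\tilde J)^{-1}-\alpha^{-1}\tilde J$; moreover $L^\#=\lim_{|\alpha|\to\infty}(L+\alpha\tilde J)^{-1}$. (ii) For every $\alpha\ne 0$, $L^\#=(L+\alpha\tilde J)^{-1}(I-\tilde J)$. (iii) If $d<n$ (that is, if $\Gamma$ has at least one arc, so that $J_{n-d-1}$ is defined), then $L^\#=\dfrac{\sigma_{n-d-1}}{\sigma_{n-d}}\,(J_{n-d-1}-\tilde J)$. (iv) $L^\#=\lim_{\tau\to\infty}\tau\,(J(\tau)-\tilde J)$, where $\tau$ is real. -/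

import Mathlib

open Filter Topology

/-- A weighted digraph without loops on the vertex set `V`, given by its matrix of arc weights:
`w i j` is the (strictly positive) weight of the arc from `i` to `j`, and it is zero iff there is
no such arc. -/
structure WeightedDigraph (V : Type*) where
  w : Matrix V V ℝ
  nonneg : ∀ i j, 0 ≤ w i j
  no_loop : ∀ i, w i i = 0

/-! A spanning subgraph is given by its set of arcs `F`, with `(i, j)` the arc from `i` to `j`. -/

namespace ArcSet

variable {V : Type*} [DecidableEq V]

/-- The number of arcs of `F` that come from `v`. -/
def outDegree (F : Finset (V × V)) (v : V) : ℕ :=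
  (F.filter (fun e => e.1 = v)).card

/-- `u` and `v` lie in the same weak component of the spanning digraph with arc set `F`. -/
def WeaklyConnected (F : Finset (V × V)) (u v : V) : Prop :=
  Relation.EqvGen (fun a b => (a, b) ∈ F) u v

/-- The spanning digraph with arc set `F` is a converging forest: in every weak component there is
a vertex (the root) of outdegree zero, and all other vertices of the component have outdegree
one. -/
def IsInForest (F : Finset (V × V)) : Prop :=
  ∀ v : V, ∃ r : V, WeaklyConnected F v r ∧ outDegree F r = 0 ∧
    ∀ u : V, WeaklyConnected F v u → u ≠ r → outDegree F u = 1

/-- The vertex `i` belongs to a tree of the forest `F` that converges to (has as its root) `j`. -/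
def ConvergesTo (F : Finset (V × V)) (i j : V) : Prop :=
  WeaklyConnected F i j ∧ outDegree F j = 0

/-- The number of weak components of the spanning digraph with arc set `F`; for an in-forest, the
number of its converging trees. -/
noncomputable def numTrees (F : Finset (V × V)) : ℕ :=
  Nat.card (Quot (fun a b : V => (a, b) ∈ F))

end ArcSet

namespace WeightedDigraph

variable {V : Type*} [Fintype V] [DecidableEq V]

/-- The weight of a spanning subgraph: the product of the weights of its arcs. -/
def weight (Γ : WeightedDigraph V) (F : Finset (V × V)) : ℝ :=
  ∏ e ∈ F, Γ.w e.1 e.2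

open Classical in
/-- The set of arcs. -/
noncomputable def arcs (Γ : WeightedDigraph V) : Finset (V × V) :=
  Finset.univ.filter (fun e => 0 < Γ.w e.1 e.2)

open Classical in
/-- The set of all in-forests (spanning converging forests) of `Γ`. -/
noncomputable def inForests (Γ : WeightedDigraph V) : Finset (Finset (V × V)) :=
  Γ.arcs.powerset.filter (fun F => ArcSet.IsInForest F)

/-- The set of in-forests with `k` arcs. -/
noncomputable def inForestsWith (Γ : WeightedDigraph V) (k : ℕ) : Finset (Finset (V × V)) :=
  Γ.inForests.filter (fun F => F.card = k)

open Classical in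
/-- The set of in-forests with `k` arcs where `i` belongs to a tree converging to `j`. -/
noncomputable def inForestsFromTo (Γ : WeightedDigraph V) (k : ℕ) (i j : V) :
    Finset (Finset (V × V)) :=
  (Γ.inForestsWith k).filter (fun F => ArcSet.ConvergesTo F i j)

/-- The in-forest dimension `d`: the minimum possible number of trees in an in-forest of `Γ`. -/
noncomputable def dim (Γ : WeightedDigraph V) : ℕ :=
  sInf {m : ℕ | ∃ F ∈ Γ.inForests, ArcSet.numTrees F = m}

/-- `σ k`: the total weight of the in-forests with `k` arcs. -/
noncomputable def σ (Γ : WeightedDigraph V) (k : ℕ) : ℝ :=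
  ∑ F ∈ Γ.inForestsWith k, Γ.weight F

/-- `σ(τ) = ∑_{k=0}^{n-d} σ_k τ^k`. -/
noncomputable def σParam (Γ : WeightedDigraph V) (τ : ℝ) : ℝ :=
  ∑ k ∈ Finset.range (Fintype.card V - Γ.dim + 1), Γ.σ k * τ ^ k

/-! All matrices below have real entries; they are regarded as matrices over `𝕜 = ℝ` or
`𝕜 = ℂ`. -/

variable (𝕜 : Type*) [RCLike 𝕜]

/-- The (row) Laplacian matrix `L`. -/
noncomputable def laplacian (Γ : WeightedDigraph V) : Matrix V V 𝕜 :=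
  Matrix.of fun i j =>
    (((if i = j then ∑ k ∈ Finset.univ.erase i, Γ.w i k else - Γ.w i j) : ℝ) : 𝕜)

/-- The matrix `Q_k` of in-forests with `k` arcs. -/
noncomputable def Q (Γ : WeightedDigraph V) (k : ℕ) : Matrix V V 𝕜 :=
  Matrix.of fun i j => ((∑ F ∈ Γ.inForestsFromTo k i j, Γ.weight F : ℝ) : 𝕜)

/-- `Q(τ) = ∑_{k=0}^{n-d} Q_k τ^k`. -/
noncomputable def QParam (Γ : WeightedDigraph V) (τ : ℝ) : Matrix V V 𝕜 :=
  ∑ k ∈ Finset.range (Fintype.card V - Γ.dim + 1), ((τ : 𝕜) ^ k) • Γ.Q 𝕜 k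

/-- The normalized matrix `J_k = σ_k⁻¹ Q_k`, for `k = 0, …, n - d`. -/
noncomputable def J (Γ : WeightedDigraph V) (k : ℕ) : Matrix V V 𝕜 :=
  ((Γ.σ k : 𝕜)⁻¹) • Γ.Q 𝕜 k

/-- `J(τ) = σ(τ)⁻¹ Q(τ)`, for `τ ≥ 0`. -/
noncomputable def JParam (Γ : WeightedDigraph V) (τ : ℝ) : Matrix V V 𝕜 :=
  ((Γ.σParam τ : 𝕜)⁻¹) • Γ.QParam 𝕜 τ

/-- The normalized matrix of maximum in-forests, `J_{n-d}`. -/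
noncomputable def Jtilde (Γ : WeightedDigraph V) : Matrix V V 𝕜 :=
  Γ.J 𝕜 (Fintype.card V - Γ.dim)

end WeightedDigraph

/-- `X` is a group inverse of the square matrix `A`. -/
def IsGroupInverse {V R : Type*} [Fintype V] [Semiring R] (A X : Matrix V V R) : Prop :=
  A * X * A = A ∧ X * A * X = X ∧ A * X = X * A

/-- A square matrix has at most one group inverse. -/
theorem IsGroupInverse.unique {V R : Type*} [Fintype V] [Semiring R] {A X Y : Matrix V V R}
    (hX : IsGroupInverse A X) (hY : IsGroupInverse A Y) : X = Y := by
  obtain ⟨x1, x2, x3⟩ := hX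
  obtain ⟨y1, y2, y3⟩ := hY
  have e : A * X = A * Y := by
    calc A * X = (A * Y * A) * X := by rw [y1]
      _ = (Y * A) * (X * A) := by rw [y3, Matrix.mul_assoc, x3]
      _ = Y * (A * X * A) := by simp only [Matrix.mul_assoc]
      _ = A * Y := by rw [x1, y3]
  calc X = X * (A * X) := by rw [← Matrix.mul_assoc, x2]
    _ = X * A * Y := by rw [e, ← Matrix.mul_assoc]
    _ = Y * A * Y := by rw [← x3, e, y3]
    _ = Y := y2

open Classical in
/-- The group inverse `A^#` of a square matrix `A`: the unique group inverse of `A` if there is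
one (and zero otherwise). -/
noncomputable def groupInverse {V R : Type*} [Fintype V] [Semiring R] (A : Matrix V V R) :
    Matrix V V R :=
  if h : ∃ X, IsGroupInverse A X then h.choose else 0

/-! The engine is the recurrence `Q_{k+1} + L Q_k = σ_{k+1} I` with `Q_0 = σ_0 I`. An in-forest is
encoded by its parent map, with the roots as fixed points. To prove row `i` of the recurrence, group
the forests by what remains after deleting the arc out of `i`. Inside each group everything cancels,
by antisymmetry in the possible heads of that arc (`sum_parentWeight_reaches`). Weighting each arc
by a variable `X` treats all `k` at once.

The rest is algebra. Each `Q_k` is a polynomial in `L`. No forest has more than `n-d` arcs, so `L J̃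
= J̃ L = 0`, and the recurrence then gives `Q_k J̃ = σ_k J̃`, whence `J̃² = J̃`. Its last step shows
that `X = (Q_{n-d-1} - σ_{n-d-1} J̃) / σ_{n-d}` satisfies `L X = I - J̃` and `X J̃ = 0`, so `X` is
the group inverse and `X + α⁻¹ J̃` inverts `L + α J̃`. Summing the recurrence against `τ^k` gives
`J(τ)(I + τL) = I`, hence `τ(J(τ) - J̃) = (I - J(τ)) X`, which tends to `(I - J̃) X = X`. -/

/-! ### Parent maps: grafting and cutting trees -/

/-- Following the map `f` from `x`, one arrives at the fixed point `j`. -/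
inductive Reaches {V : Type*} (f : V → V) : V → V → Prop
  | root {j : V} : f j = j → Reaches f j j
  | step {x j : V} : Reaches f (f x) j → Reaches f x j

/-- Every orbit of `f` arrives at a fixed point. -/
def IsParentMap {V : Type*} (f : V → V) : Prop :=
  ∀ x, ∃ j, Reaches f x j

namespace Reaches

variable {V : Type*} {f : V → V} {x i j k : V}

theorem isFixed (h : Reaches f x j) : f j = j := by
  induction h with
  | root h => exact h
  | step _ ih => exact ih

theorem next (h : Reaches f x j) : Reaches f (f x) j := by
  cases h with
  | root h => rw [h]; exact .root h
  | step h => exact h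

theorem next_iff : Reaches f (f x) j ↔ Reaches f x j := ⟨.step, next⟩

theorem eq_of_isFixed (h : Reaches f x j) (hx : f x = x) : x = j := by
  induction h with
  | root _ => rfl
  | step _ ih => rw [hx] at ih; exact ih hx

theorem unique (h : Reaches f x j) (h' : Reaches f x k) : j = k := by
  induction h with
  | root h => exact h'.eq_of_isFixed h
  | step _ ih => exact ih h'.next

variable [DecidableEq V] {g : V → V} {v : V}

theorem update_of_ne (hi : g i = i) (h : Reaches g x j) (hj : j ≠ i) :
    Reaches (Function.update g i v) x j := by
  induction h with
  | root h => exact .root (by rw [Function.update_of_ne hj, h])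
  | @step x j h ih =>
    have hx : x ≠ i := by
      rintro rfl
      exact hj (h.step.eq_of_isFixed hi).symm
    refine .step ?_
    rw [Function.update_of_ne hx]
    exact ih hj

theorem update_of_root (hi : g i = i) (hv : Reaches g v j) (hj : j ≠ i) (h : Reaches g x i) :
    Reaches (Function.update g i v) x j := by
  have base : Reaches (Function.update g i v) i j :=
    .step (by rw [Function.update_self]; exact hv.update_of_ne hi hj)
  induction h with
  | root h => exact base
  | @step x i h ih =>
    by_cases hx : x = i
    · rw [hx]; exact base
    · refine .step ?_
      rw [Function.update_of_ne hx]
      exact ih hi hj base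

theorem update_self (h : Reaches f x j) :
    Reaches (Function.update f i i) x j ∨ Reaches (Function.update f i i) x i := by
  induction h with
  | @root j h =>
    by_cases hj : j = i
    · subst hj; exact .inl (.root (Function.update_self ..))
    · exact .inl (.root (by rw [Function.update_of_ne hj, h]))
  | @step x j h ih =>
    by_cases hx : x = i
    · subst hx; exact .inr (.root (Function.update_self ..))
    · rw [← Function.update_of_ne hx i f] at ih
      exact ih.imp .step .step

/-- If `f i` still led to `i` after the arc out of `i` is cut, `f` would have a cycle through `i`
and `f i` would reach no root. -/
theorem not_update_self (hi : f i ≠ i) (h : Reaches f (f i) j) :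
    ¬ Reaches (Function.update f i i) (f i) i := by
  intro hc
  suffices ∀ x k, Reaches f x k → ¬ Reaches (Function.update f i i) x i from this _ _ h hc
  clear h
  intro x k h
  induction h with
  | @root j h =>
    intro h'
    by_cases hj : j = i
    · exact hi (hj ▸ h)
    · exact hj (h'.eq_of_isFixed (by rw [Function.update_of_ne hj, h]))
  | @step x j h ih =>
    intro h'
    by_cases hx : x = i
    -- The path has come to `i`, so its next vertex is `f i`, to which the assumption `hc` applies.
    · subst hx; exact ih hc
    · have := h'.next
      rw [Function.update_of_ne hx] at this
      exact ih this

end Reaches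

namespace IsParentMap

variable {V : Type*} [DecidableEq V] {f g : V → V} {i v : V}

theorem update_self (hf : IsParentMap f) (i : V) : IsParentMap (Function.update f i i) := fun x =>
  let ⟨_, h⟩ := hf x
  h.update_self.elim (fun h => ⟨_, h⟩) (fun h => ⟨_, h⟩)

open Classical in
-- Grafting the tree rooted at `i` onto `v` gives its vertices the root of `v` and leaves the other
-- trees alone; no cycle arises because `v` lies outside that tree.
theorem reaches_update_iff (hg : IsParentMap g) (hi : g i = i) (hv : ¬ Reaches g v i) (x j : V) :
    Reaches (Function.update g i v) x j ↔ if Reaches g x i then Reaches g v j else Reaches g x j := by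
  obtain ⟨k, hk⟩ := hg v
  have hki : k ≠ i := by rintro rfl; exact hv hk
  split_ifs with h
  · have h1 := Reaches.update_of_root hi hk hki h
    exact ⟨fun h2 => h1.unique h2 ▸ hk, fun h2 => hk.unique h2 ▸ h1⟩
  · obtain ⟨l, hl⟩ := hg x
    have hli : l ≠ i := by rintro rfl; exact h hl
    have h1 := hl.update_of_ne (v := v) hi hli
    exact ⟨fun h2 => h1.unique h2 ▸ hl, fun h2 => hl.unique h2 ▸ h1⟩

theorem update (hg : IsParentMap g) (hi : g i = i) (hv : ¬ Reaches g v i) :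
    IsParentMap (Function.update g i v) := by
  intro x
  simp only [hg.reaches_update_iff hi hv]
  split_ifs
  exacts [hg v, hg x]

end IsParentMap

/-! ### The forest recurrence over a commutative ring -/

section ForestIdentity

variable {V R : Type*} [Fintype V] [DecidableEq V] [CommRing R]

/-- The weight of the spanning subgraph with the arcs `(x, f x)` for `f x ≠ x`. -/
def parentWeight (w : V → V → R) (f : V → V) : R :=
  ∏ x, if f x = x then 1 else w x (f x)

theorem parentWeight_update (w : V → V → R) {g : V → V} {i v : V} (hi : g i = i) (hv : v ≠ i) :
    parentWeight w (Function.update g i v) = w i v * parentWeight w g := by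
  unfold parentWeight
  rw [← Finset.mul_prod_erase Finset.univ _ (Finset.mem_univ i),
    ← Finset.mul_prod_erase Finset.univ (fun x => if g x = x then 1 else w x (g x))
      (Finset.mem_univ i)]
  simp only [Function.update_self, hi, hv, if_true, if_false, one_mul]
  congr 1
  refine Finset.prod_congr rfl fun x hx => ?_
  rw [Function.update_of_ne (Finset.ne_of_mem_erase hx)]

open Classical in
/-- The maps all of whose orbits arrive at a fixed point. -/
noncomputable def parentMaps (V : Type*) [Fintype V] : Finset (V → V) :=
  Finset.univ.filter IsParentMap

open Classical in
-- Groups the forests by the forest `g` left after cutting the arc out of `i`: a group consists of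
-- `g` and its grafts of `i` onto vertices outside the tree of `i`.
theorem sum_parentMaps_split (i : V) (φ : (V → V) → R) :
    ∑ f ∈ parentMaps V, φ f =
      ∑ g ∈ (parentMaps V).filter (fun g => g i = i),
        (φ g + ∑ v ∈ Finset.univ.filter (fun v => ¬ Reaches g v i), φ (Function.update g i v)) := by
  rw [Finset.sum_add_distrib, ← Finset.sum_filter_add_sum_filter_not _ (fun f : V → V => f i = i)]
  congr 1
  rw [Finset.sum_sigma']
  symm
  refine Finset.sum_bij' (fun p _ => Function.update p.1 i p.2)
    (fun f _ => ⟨Function.update f i i, f i⟩) ?_ ?_ ?_ ?_ ?_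
  · rintro ⟨g, v⟩ h
    simp only [parentMaps, Finset.mem_sigma, Finset.mem_filter, Finset.mem_univ, true_and] at h ⊢
    refine ⟨h.1.1.update h.1.2 h.2, ?_⟩
    rw [Function.update_self]
    rintro rfl
    exact h.2 (.root h.1.2)
  · intro f h
    simp only [parentMaps, Finset.mem_sigma, Finset.mem_filter, Finset.mem_univ, true_and] at h ⊢
    obtain ⟨j, hj⟩ := h.1 (f i)
    exact ⟨⟨h.1.update_self i, Function.update_self ..⟩, hj.not_update_self h.2⟩
  · rintro ⟨g, v⟩ h
    simp only [parentMaps, Finset.mem_sigma, Finset.mem_filter, Finset.mem_univ, true_and] at h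
    have : Function.update g i i = g := by
      conv_lhs => rw [← h.1.2]
      rw [h.1.2, Function.update_eq_self_iff, h.1.2]
    simp [this]
  · intro f h
    simp
  · intros; rfl

open Classical in
-- With `a` and `ρ` as in the proof, and up to the common factor `parentWeight w g`, the forest `g`
-- contributes `∑ a u (δ - ρ u)`. Its grafts contribute `∑ a v (ρ v - δ)`, which cancels this, plus
-- a double sum antisymmetric in `u` and `v`.
theorem sum_parentWeight_reaches (w : V → V → R) (i j : V) :
    (∑ f ∈ parentMaps V, parentWeight w f * (if Reaches f i j then 1 else 0)) +
      ∑ u, w i u * ((∑ f ∈ parentMaps V, parentWeight w f * (if Reaches f i j then 1 else 0)) -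
        ∑ f ∈ parentMaps V, parentWeight w f * (if Reaches f u j then 1 else 0)) =
      if i = j then ∑ f ∈ parentMaps V, parentWeight w f else 0 := by
  set δ : R := if i = j then 1 else 0 with hδ
  have key : ∑ f ∈ parentMaps V, parentWeight w f * ((if Reaches f i j then 1 else 0) +
      (∑ u, w i u * ((if Reaches f i j then 1 else 0) - (if Reaches f u j then 1 else 0))) - δ)
      = 0 := by
    rw [sum_parentMaps_split i]
    refine Finset.sum_eq_zero fun g hg => ?_
    simp only [parentMaps, Finset.mem_filter, Finset.mem_univ, true_and] at hg
    obtain ⟨hg, hi⟩ := hg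
    -- Arcs from `i` into its own tree are dropped: they cannot be grafted, and in the Laplacian
    -- term their two indicators agree.
    set a : V → R := fun v => if Reaches g v i then 0 else w i v with ha
    set ρ : V → R := fun v => if Reaches g v j then 1 else 0 with hρ
    have hT : ∀ u, Reaches g u i → ρ u = δ := by
      intro u hu
      have : Reaches g u j ↔ i = j := ⟨fun h => hu.unique h, fun h => h ▸ hu⟩
      simp only [hρ, hδ, this]
    have hroot : parentWeight w g * ((if Reaches g i j then 1 else 0) +
        (∑ u, w i u * ((if Reaches g i j then 1 else 0) - (if Reaches g u j then 1 else 0))) - δ)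
        = parentWeight w g * ∑ u, a u * (δ - ρ u) := by
      congr 1
      have h1 : (if Reaches g i j then 1 else 0 : R) = δ := hT i (.root hi)
      rw [h1, add_sub_cancel_left]
      refine Finset.sum_congr rfl fun u _ => ?_
      change _ * (δ - ρ u) = _
      by_cases hu : Reaches g u i
      · rw [hT u hu]; simp
      · simp [ha, hu]
    have hext : ∀ v, ¬ Reaches g v i → parentWeight w (Function.update g i v) *
        ((if Reaches (Function.update g i v) i j then 1 else 0) +
        (∑ u, w i u * ((if Reaches (Function.update g i v) i j then 1 else 0) -
          (if Reaches (Function.update g i v) u j then 1 else 0))) - δ)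
        = parentWeight w g * (a v * (ρ v - δ) + ∑ u, a v * a u * (ρ v - ρ u)) := by
      intro v hv
      have hvi : v ≠ i := by rintro rfl; exact hv (.root hi)
      have hav : a v = w i v := by simp [ha, hv]
      have h1 : ∀ u, (if Reaches (Function.update g i v) u j then 1 else 0 : R) =
          if Reaches g u i then ρ v else ρ u := by
        intro u
        simp only [hg.reaches_update_iff hi hv, hρ]
        split_ifs <;> rfl
      have h2 : (if Reaches (Function.update g i v) i j then 1 else 0 : R) = ρ v := by
        rw [h1, if_pos (.root hi)]
      have h3 : ∑ u, w i u * ((if Reaches (Function.update g i v) i j then 1 else 0) -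
          (if Reaches (Function.update g i v) u j then 1 else 0)) =
          ∑ u, a u * (ρ v - ρ u) := by
        refine Finset.sum_congr rfl fun u _ => ?_
        rw [h2, h1]
        by_cases hu : Reaches g u i <;> simp [ha, hu]
      rw [h3, h2, parentWeight_update w hi hvi, hav]
      simp only [mul_assoc, ← Finset.mul_sum]
      ring
    rw [hroot, Finset.sum_congr rfl fun v hv => hext v (Finset.mem_filter.1 hv).2,
      ← Finset.mul_sum, ← mul_add]
    have hall : ∑ v ∈ Finset.univ.filter (fun v => ¬ Reaches g v i),
        (a v * (ρ v - δ) + ∑ u, a v * a u * (ρ v - ρ u)) =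
        ∑ v, (a v * (ρ v - δ) + ∑ u, a v * a u * (ρ v - ρ u)) := by
      refine Finset.sum_subset (Finset.filter_subset _ _) fun v _ hv => ?_
      have hv' : Reaches g v i := by simpa using hv
      have : a v = 0 := by simp [ha, hv']
      simp [this]
    have hanti : ∑ v, ∑ u, a v * a u * (ρ v - ρ u) = 0 := by
      simp only [mul_sub, Finset.sum_sub_distrib]
      rw [Finset.sum_comm, sub_eq_zero]
      exact Finset.sum_congr rfl fun u _ => Finset.sum_congr rfl fun v _ => by ring
    rw [hall, Finset.sum_add_distrib, hanti, add_zero, ← Finset.sum_add_distrib]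
    simp [← mul_add]
  have hδS : (if i = j then ∑ f ∈ parentMaps V, parentWeight w f else 0) =
      ∑ f ∈ parentMaps V, parentWeight w f * δ := by
    rw [hδ, ← Finset.sum_mul]; split_ifs <;> simp
  have hswap : ∑ f ∈ parentMaps V, parentWeight w f *
      ∑ u, w i u * ((if Reaches f i j then 1 else 0) - (if Reaches f u j then 1 else 0)) =
      ∑ u, w i u * ((∑ f ∈ parentMaps V, parentWeight w f * (if Reaches f i j then 1 else 0)) -
        ∑ f ∈ parentMaps V, parentWeight w f * (if Reaches f u j then 1 else 0)) := by
    simp_rw [← Finset.sum_sub_distrib, Finset.mul_sum]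
    rw [Finset.sum_comm]
    exact Finset.sum_congr rfl fun u _ => Finset.sum_congr rfl fun f _ => by ring
  simp only [mul_sub (parentWeight w _), mul_add (parentWeight w _), Finset.sum_sub_distrib,
    Finset.sum_add_distrib] at key
  rw [hδS, ← hswap]
  exact sub_eq_zero.1 key

end ForestIdentity

/-! ### In-forests as parent maps -/

namespace ArcSet

variable {V : Type*} [Fintype V] [DecidableEq V]

/-- The arcs `(x, f x)` with `f x ≠ x`. -/
def ofMap (f : V → V) : Finset (V × V) :=
  Finset.univ.filter fun e => f e.1 = e.2 ∧ e.1 ≠ e.2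

@[simp] theorem mem_ofMap {f : V → V} {a b : V} : (a, b) ∈ ofMap f ↔ f a = b ∧ a ≠ b := by
  simp [ofMap]

theorem ofMap_eq_image (f : V → V) :
    ofMap f = (Finset.univ.filter fun x => f x ≠ x).image fun x => (x, f x) := by
  ext ⟨a, b⟩
  simp only [mem_ofMap, Finset.mem_image, Finset.mem_filter, Finset.mem_univ, true_and,
    Prod.mk.injEq]
  constructor
  · rintro ⟨rfl, h⟩; exact ⟨a, h.symm, rfl, rfl⟩
  · rintro ⟨x, h, rfl, rfl⟩; exact ⟨rfl, h.symm⟩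

theorem ofMap_injective : Function.Injective (ofMap (V := V)) := by
  intro f g h
  funext x
  by_contra hne
  by_cases hf : f x = x
  · have : (x, g x) ∈ ofMap f := by
      rw [h, mem_ofMap]; exact ⟨rfl, fun h' => hne (hf.trans h')⟩
    exact hne (mem_ofMap.1 this).1
  · have : (x, f x) ∈ ofMap g := by
      rw [← h, mem_ofMap]; exact ⟨rfl, fun h' => hf h'.symm⟩
    exact hne (mem_ofMap.1 this).1.symm

theorem card_ofMap (f : V → V) : (ofMap f).card = (Finset.univ.filter fun x => f x ≠ x).card := by
  rw [ofMap_eq_image]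
  exact Finset.card_image_of_injective _ fun x y h => (Prod.mk.inj h).1

theorem outDegree_ofMap (f : V → V) (x : V) :
    outDegree (ofMap f) x = if f x = x then 0 else 1 := by
  unfold outDegree
  split_ifs with h
  · rw [Finset.card_eq_zero, Finset.filter_eq_empty_iff]
    rintro ⟨a, b⟩ hab rfl
    exact (mem_ofMap.1 hab).2 (h.symm.trans (mem_ofMap.1 hab).1)
  · rw [Finset.card_eq_one]
    refine ⟨(x, f x), ?_⟩
    ext ⟨a, b⟩
    simp only [Finset.mem_filter, mem_ofMap, Finset.mem_singleton, Prod.mk.injEq]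
    constructor
    · rintro ⟨⟨rfl, -⟩, rfl⟩; exact ⟨rfl, rfl⟩
    · rintro ⟨rfl, rfl⟩; exact ⟨⟨rfl, fun h' => h h'.symm⟩, rfl⟩

theorem outDegree_ofMap_eq_zero {f : V → V} {x : V} : outDegree (ofMap f) x = 0 ↔ f x = x := by
  rw [outDegree_ofMap]; simp

theorem WeaklyConnected.reaches_iff {f : V → V} {u v j : V}
    (h : WeaklyConnected (ofMap f) u v) : Reaches f u j ↔ Reaches f v j := by
  unfold WeaklyConnected at h
  induction h with
  | rel a b h => rw [← (mem_ofMap.1 h).1, Reaches.next_iff]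
  | refl => rfl
  | symm _ _ _ ih => exact ih.symm
  | trans _ _ _ _ _ ih₁ ih₂ => exact ih₁.trans ih₂

theorem _root_.Reaches.weaklyConnected {f : V → V} {x j : V} (h : Reaches f x j) :
    WeaklyConnected (ofMap f) x j := by
  induction h with
  | root => exact .refl _
  | @step x j _ ih =>
    by_cases hx : f x = x
    · rwa [hx] at ih
    · exact .trans _ _ _ (.rel _ _ (mem_ofMap.2 ⟨rfl, fun h => hx h.symm⟩)) ih

theorem convergesTo_ofMap {f : V → V} {x j : V} :
    ConvergesTo (ofMap f) x j ↔ Reaches f x j := by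
  unfold ConvergesTo
  rw [outDegree_ofMap_eq_zero]
  exact ⟨fun h => h.1.reaches_iff.2 (.root h.2), fun h => ⟨h.weaklyConnected, h.isFixed⟩⟩

theorem _root_.IsParentMap.isInForest {f : V → V} (hf : IsParentMap f) :
    IsInForest (ofMap f) := by
  intro v
  obtain ⟨r, hr⟩ := hf v
  refine ⟨r, hr.weaklyConnected, outDegree_ofMap_eq_zero.2 hr.isFixed, fun u hu hur => ?_⟩
  rw [outDegree_ofMap, if_neg]
  exact fun h => hur ((hu.reaches_iff.1 hr).eq_of_isFixed h)

/-- Outdegrees are at most one, so the arcs form a partial function, which is extended by the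
identity at the roots. A loop would be invisible in this encoding. -/
theorem IsInForest.exists_ofMap {F : Finset (V × V)} (hF : IsInForest F)
    (hloop : ∀ x, (x, x) ∉ F) : ∃ f, IsParentMap f ∧ ofMap f = F := by
  classical
  have hdeg : ∀ a b c, (a, b) ∈ F → (a, c) ∈ F → b = c := by
    intro a b c hb hc
    have hle : outDegree F a ≤ 1 := by
      obtain ⟨r, -, h0, h1⟩ := hF a
      by_cases har : a = r
      · rw [har, h0]; exact zero_le_one
      · exact (h1 a (.refl _) har).le
    have := Finset.card_le_one.1 hle (a, b) (by simp [hb]) (a, c) (by simp [hc])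
    exact (Prod.mk.inj this).2
  set f : V → V := fun x => if h : ∃ y, (x, y) ∈ F then h.choose else x with hfdef
  have hf : ∀ a b, (a, b) ∈ F → f a = b := by
    intro a b hab
    have h : ∃ y, (a, y) ∈ F := ⟨b, hab⟩
    simp only [hfdef, dif_pos h]
    exact hdeg a _ _ h.choose_spec hab
  have hF' : ofMap f = F := by
    ext ⟨a, b⟩
    rw [mem_ofMap]
    refine ⟨?_, fun h => ⟨hf a b h, ?_⟩⟩
    · rintro ⟨rfl, hne⟩
      by_cases h : ∃ y, (a, y) ∈ F
      · obtain ⟨y, hy⟩ := h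
        rwa [hf a y hy]
      · exact absurd (by simp only [hfdef, dif_neg h]) hne
    · rintro rfl; exact hloop _ h
  refine ⟨f, fun x => ?_, hF'⟩
  obtain ⟨r, hr, h0, -⟩ := hF x
  rw [← hF'] at hr h0
  exact ⟨r, convergesTo_ofMap.1 ⟨hr, h0⟩⟩

/-- Each weak component contains exactly one fixed point, and every other vertex emits one arc. -/
theorem numTrees_ofMap {f : V → V} (hf : IsParentMap f) :
    numTrees (ofMap f) = Fintype.card V - (ofMap f).card := by
  have hbij : Function.Bijective
      (fun x : {x // f x = x} => Quot.mk (fun a b : V => (a, b) ∈ ofMap f) x.1) := by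
    constructor
    · rintro ⟨x, hx⟩ ⟨y, hy⟩ h
      have h' : WeaklyConnected (ofMap f) x y := Quot.eqvGen_exact h
      exact Subtype.ext ((h'.reaches_iff.2 (.root hy)).eq_of_isFixed hx)
    · intro q
      induction q using Quot.ind with
      | mk x =>
        obtain ⟨j, hj⟩ := hf x
        exact ⟨⟨j, hj.isFixed⟩, (Quot.eqvGen_sound hj.weaklyConnected).symm⟩
  unfold numTrees
  rw [← Nat.card_congr (Equiv.ofBijective _ hbij), Nat.card_eq_fintype_card,
    Fintype.card_subtype, card_ofMap]
  have := Finset.card_filter_add_card_filter_not (s := (Finset.univ : Finset V))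
    (fun x => f x = x)
  rw [Finset.card_univ] at this
  simp only [ne_eq]
  omega

end ArcSet

/-! ### Generating polynomials and the maximum number of arcs -/

namespace WeightedDigraph

open ArcSet Polynomial

theorem mem_arcs {V : Type*} [Fintype V] (Γ : WeightedDigraph V) {a b : V} : (a, b) ∈ Γ.arcs ↔ 0 < Γ.w a b := by simp [arcs]

variable {V : Type*} [Fintype V] [DecidableEq V] (Γ : WeightedDigraph V)

theorem weight_pos {F : Finset (V × V)} (hF : F ∈ Γ.inForests) : 0 < Γ.weight F := by
  simp only [inForests, Finset.mem_filter, Finset.mem_powerset] at hF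
  exact Finset.prod_pos fun e he => Γ.mem_arcs.1 (hF.1 he)

theorem exists_ofMap_of_mem_inForests {F : Finset (V × V)} (hF : F ∈ Γ.inForests) :
    ∃ f, IsParentMap f ∧ ofMap f = F := by
  simp only [inForests, Finset.mem_filter, Finset.mem_powerset] at hF
  refine hF.2.exists_ofMap fun x hx => ?_
  have := Γ.mem_arcs.1 (hF.1 hx)
  rw [Γ.no_loop] at this
  exact this.false

theorem weight_ofMap_eq_zero {f : V → V} (hf : IsParentMap f) (h : ofMap f ∉ Γ.inForests) :
    Γ.weight (ofMap f) = 0 := by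
  simp only [inForests, Finset.mem_filter, Finset.mem_powerset, hf.isInForest, and_true,
    Finset.subset_iff, not_forall] at h
  obtain ⟨⟨a, b⟩, hab, hab'⟩ := h
  refine Finset.prod_eq_zero hab ?_
  rw [Γ.mem_arcs, not_lt] at hab'
  exact le_antisymm hab' (Γ.nonneg a b)

theorem parentWeight_X_mul_C (f : V → V) :
    parentWeight (fun x y => (X * C (Γ.w x y) : ℝ[X])) f =
      C (Γ.weight (ofMap f)) * X ^ (ofMap f).card := by
  have h : (∏ x, if f x = x then 1 else (X * C (Γ.w x (f x)) : ℝ[X])) =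
      ∏ x ∈ Finset.univ.filter (fun x => f x ≠ x), (X * C (Γ.w x (f x)) : ℝ[X]) := by
    rw [Finset.prod_filter]
    exact Finset.prod_congr rfl fun x _ => by by_cases h : f x = x <;> simp [h]
  unfold parentWeight weight
  rw [h, Finset.prod_mul_distrib, Finset.prod_const, card_ofMap, mul_comm, ← map_prod]
  congr 2
  rw [ofMap_eq_image, Finset.prod_image fun x _ y _ h => (Prod.mk.inj h).1]

open Classical in
-- The sum may run over all parent maps, since those using an absent arc have weight zero; the
-- exponent of `X` counts arcs.
theorem sum_inForestsWith_eq_coeff (k : ℕ) (p : Finset (V × V) → Prop) :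
    ∑ F ∈ (Γ.inForestsWith k).filter p, Γ.weight F =
      (∑ f ∈ parentMaps V, parentWeight (fun x y => (X * C (Γ.w x y) : ℝ[X])) f *
        (if p (ofMap f) then 1 else 0)).coeff k := by
  rw [finsetSum_coeff]
  simp only [parentWeight_X_mul_C, mul_ite, mul_one, mul_zero, apply_ite (coeff · k), coeff_zero,
    coeff_C_mul_X_pow]
  rw [← Finset.sum_image (s := parentMaps V) (g := ofMap)
    (f := fun F => if p F then if k = F.card then Γ.weight F else 0 else 0)
    (fun f _ g _ h => ofMap_injective h)]
  have hsub : Γ.inForests ⊆ (parentMaps V).image ofMap := by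
    intro F hF
    obtain ⟨f, hf, rfl⟩ := Γ.exists_ofMap_of_mem_inForests hF
    exact Finset.mem_image_of_mem _ (by simpa [parentMaps] using hf)
  rw [← Finset.sum_subset hsub]
  · rw [inForestsWith, Finset.filter_filter, Finset.sum_filter]
    refine Finset.sum_congr rfl fun F _ => ?_
    by_cases h₁ : p F <;> by_cases h₂ : F.card = k <;> simp [h₁, h₂]
    exact fun h => absurd h.symm h₂
  · rintro F hF hF'
    obtain ⟨f, hf, rfl⟩ := Finset.mem_image.1 hF
    rw [Γ.weight_ofMap_eq_zero (by simpa [parentMaps] using hf) hF']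
    simp

theorem σ_eq_coeff (k : ℕ) : Γ.σ k =
    (∑ f ∈ parentMaps V, parentWeight (fun x y => (X * C (Γ.w x y) : ℝ[X])) f).coeff k := by
  have h := Γ.sum_inForestsWith_eq_coeff k (fun _ => True)
  simp only [Finset.filter_true, if_true, mul_one] at h
  exact h

/-- The total weight of the in-forests with `k` arcs where `i` belongs to a tree with root `j`. -/
noncomputable def forestWeight (k : ℕ) (i j : V) : ℝ :=
  ∑ F ∈ Γ.inForestsFromTo k i j, Γ.weight F

open Classical in
theorem forestWeight_eq_coeff (k : ℕ) (i j : V) : Γ.forestWeight k i j =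
    (∑ f ∈ parentMaps V, parentWeight (fun x y => (X * C (Γ.w x y) : ℝ[X])) f *
      (if Reaches f i j then 1 else 0)).coeff k := by
  have := Γ.sum_inForestsWith_eq_coeff k (fun F => ConvergesTo F i j)
  simp only [convergesTo_ofMap] at this
  exact this

theorem forestWeight_zero (i j : V) : Γ.forestWeight 0 i j = if i = j then Γ.σ 0 else 0 := by
  have h := congrArg (coeff · 0)
    (sum_parentWeight_reaches (fun x y => (X * C (Γ.w x y) : ℝ[X])) i j)
  simp only [coeff_add, finsetSum_coeff (s := (Finset.univ : Finset V)), mul_assoc X, coeff_X_mul_zero,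
    Finset.sum_const_zero, add_zero, apply_ite (coeff · 0), coeff_zero] at h
  rw [forestWeight_eq_coeff, σ_eq_coeff]
  exact h

/-- Compare coefficients of `X ^ (k + 1)`: the weights in the Laplacian term carry one factor `X`,
which shifts its index to `k`. -/
theorem forestWeight_succ (k : ℕ) (i j : V) :
    Γ.forestWeight (k + 1) i j +
      ∑ u, Γ.w i u * (Γ.forestWeight k i j - Γ.forestWeight k u j) =
      if i = j then Γ.σ (k + 1) else 0 := by
  have h := congrArg (coeff · (k + 1))
    (sum_parentWeight_reaches (fun x y => (X * C (Γ.w x y) : ℝ[X])) i j)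
  simp only [coeff_add, finsetSum_coeff (s := (Finset.univ : Finset V)), mul_assoc X, coeff_X_mul,
    coeff_C_mul, coeff_sub, apply_ite (coeff · (k + 1)), coeff_zero] at h
  simp only [forestWeight_eq_coeff, σ_eq_coeff]
  exact h

theorem empty_mem_inForests : ∅ ∈ Γ.inForests := by
  have h : ofMap (id : V → V) = ∅ := by
    ext ⟨a, b⟩; simp
  have hid : IsParentMap (id : V → V) := fun x => ⟨x, .root rfl⟩
  have := hid.isInForest
  rw [h] at this
  simp [inForests, this]

theorem card_le_of_mem_inForests {F : Finset (V × V)} (hF : F ∈ Γ.inForests) :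
    F.card ≤ Fintype.card V - Γ.dim := by
  obtain ⟨f, hf, rfl⟩ := Γ.exists_ofMap_of_mem_inForests hF
  have h1 : Γ.dim ≤ numTrees (ofMap f) := Nat.sInf_le ⟨_, hF, rfl⟩
  have h2 : (ofMap f).card ≤ Fintype.card V := by
    rw [card_ofMap]; exact Finset.card_le_univ _
  rw [numTrees_ofMap hf] at h1
  omega

theorem exists_mem_inForests_card_eq : ∃ F ∈ Γ.inForests, F.card = Fintype.card V - Γ.dim := by
  -- The arcless forest makes the set nonempty, so the minimum is attained.
  obtain ⟨F, hF, h1⟩ := Nat.sInf_mem (s := {m : ℕ | ∃ F ∈ Γ.inForests, numTrees F = m})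
    ⟨_, ∅, Γ.empty_mem_inForests, rfl⟩
  obtain ⟨f, hf, rfl⟩ := Γ.exists_ofMap_of_mem_inForests hF
  refine ⟨_, hF, ?_⟩
  have h2 : (ofMap f).card ≤ Fintype.card V := by
    rw [card_ofMap]; exact Finset.card_le_univ _
  change _ = Γ.dim at h1
  rw [numTrees_ofMap hf] at h1
  omega

theorem inForestsWith_subset (k : ℕ) : Γ.inForestsWith k ⊆ Γ.inForests :=
  Finset.filter_subset _ _

theorem σ_top_pos : 0 < Γ.σ (Fintype.card V - Γ.dim) := by
  obtain ⟨F, hF, hc⟩ := Γ.exists_mem_inForests_card_eq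
  exact Finset.sum_pos (fun F hF => Γ.weight_pos (Γ.inForestsWith_subset _ hF))
    ⟨F, Finset.mem_filter.2 ⟨hF, hc⟩⟩

theorem inForestsWith_eq_empty {k : ℕ} (hk : Fintype.card V - Γ.dim < k) :
    Γ.inForestsWith k = ∅ := by
  refine Finset.filter_eq_empty_iff.2 fun F hF hc => ?_
  have := Γ.card_le_of_mem_inForests hF
  omega

theorem σ_eq_zero {k : ℕ} (hk : Fintype.card V - Γ.dim < k) : Γ.σ k = 0 := by
  rw [σ, Γ.inForestsWith_eq_empty hk, Finset.sum_empty]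

theorem inForestsWith_eq_empty_of_σ_eq_zero {k : ℕ} (h : Γ.σ k = 0) : Γ.inForestsWith k = ∅ := by
  by_contra hne
  exact (Finset.sum_pos (fun F hF => Γ.weight_pos (Γ.inForestsWith_subset _ hF))
    (Finset.nonempty_iff_ne_empty.2 hne)).ne' h

theorem forestWeight_eq_zero_of_σ_eq_zero {k : ℕ} (h : Γ.σ k = 0) (i j : V) :
    Γ.forestWeight k i j = 0 := by
  rw [forestWeight, inForestsFromTo, Γ.inForestsWith_eq_empty_of_σ_eq_zero h, Finset.filter_empty,
    Finset.sum_empty]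

end WeightedDigraph

/-! ### Matrix algebra of the forest matrices -/

theorem IsGroupInverse.groupInverse_eq {V R : Type*} [Fintype V] [Semiring R] {A X : Matrix V V R}
    (h : IsGroupInverse A X) : groupInverse A = X := by
  have hex : ∃ X, IsGroupInverse A X := ⟨X, h⟩
  rw [groupInverse, dif_pos hex]
  exact hex.choose_spec.unique h

namespace WeightedDigraph

variable {V : Type*} [Fintype V] [DecidableEq V] (𝕜 : Type*) [RCLike 𝕜] (Γ : WeightedDigraph V)

theorem laplacian_mul_apply (M : Matrix V V 𝕜) (i j : V) :
    (Γ.laplacian 𝕜 * M) i j = ∑ u, (Γ.w i u : 𝕜) * (M i j - M u j) := by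
  have h : ∀ u, Γ.laplacian 𝕜 i u = (if i = u then ∑ k, (Γ.w i k : 𝕜) else 0) - (Γ.w i u : 𝕜) := by
    intro u
    unfold laplacian
    rw [Matrix.of_apply]
    by_cases hiu : i = u
    · subst hiu
      rw [if_pos rfl, if_pos rfl, Γ.no_loop, ← Finset.add_sum_erase _ _ (Finset.mem_univ i),
        Γ.no_loop]
      push_cast
      ring
    · rw [if_neg hiu, if_neg hiu]
      push_cast
      ring
  simp only [Matrix.mul_apply, h, sub_mul, ite_mul, zero_mul, Finset.sum_sub_distrib,
    Finset.sum_ite_eq, Finset.mem_univ, if_true, mul_sub, ← Finset.sum_mul]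

theorem Q_apply (k : ℕ) (i j : V) : Γ.Q 𝕜 k i j = (Γ.forestWeight k i j : 𝕜) := rfl

theorem Q_zero : Γ.Q 𝕜 0 = (Γ.σ 0 : 𝕜) • 1 := by
  ext i j
  rw [Q_apply, forestWeight_zero, Matrix.smul_apply, Matrix.one_apply]
  split_ifs <;> simp

theorem Q_succ_add (k : ℕ) :
    Γ.Q 𝕜 (k + 1) + Γ.laplacian 𝕜 * Γ.Q 𝕜 k = (Γ.σ (k + 1) : 𝕜) • 1 := by
  ext i j
  have h := congrArg (fun x : ℝ => (x : 𝕜)) (Γ.forestWeight_succ k i j)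
  rw [Matrix.add_apply, laplacian_mul_apply, Matrix.smul_apply, Matrix.one_apply]
  simp only [Q_apply]
  push_cast at h
  rw [h]
  split_ifs <;> simp

theorem Q_succ (k : ℕ) :
    Γ.Q 𝕜 (k + 1) = (Γ.σ (k + 1) : 𝕜) • 1 - Γ.laplacian 𝕜 * Γ.Q 𝕜 k :=
  eq_sub_of_add_eq (Γ.Q_succ_add 𝕜 k)

theorem commute_laplacian_Q (k : ℕ) : Commute (Γ.laplacian 𝕜) (Γ.Q 𝕜 k) := by
  induction k with
  | zero => rw [Q_zero]; exact (Commute.one_right _).smul_right _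
  | succ k ih =>
    rw [Q_succ]
    exact ((Commute.one_right _).smul_right _).sub_right ((Commute.refl _).mul_right ih)

theorem Q_eq_zero_of_σ_eq_zero {k : ℕ} (h : Γ.σ k = 0) : Γ.Q 𝕜 k = 0 := by
  ext i j
  rw [Q_apply, Γ.forestWeight_eq_zero_of_σ_eq_zero h]
  simp

/-- True even if `σ k = 0`: weights of in-forests are positive, so then there are none with `k` arcs
and `Q_k = 0`. -/
theorem σ_smul_J (k : ℕ) : (Γ.σ k : 𝕜) • Γ.J 𝕜 k = Γ.Q 𝕜 k := by
  unfold J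
  by_cases h : Γ.σ k = 0
  · simp [h, Γ.Q_eq_zero_of_σ_eq_zero 𝕜 h]
  · rw [smul_inv_smul₀ (by exact_mod_cast h)]

theorem σ_top_ne_zero : (Γ.σ (Fintype.card V - Γ.dim) : 𝕜) ≠ 0 := by
  exact_mod_cast Γ.σ_top_pos.ne'

/-- The recurrence at `k = n - d`, where both terms of index `n - d + 1` vanish. -/
theorem laplacian_mul_Jtilde : Γ.laplacian 𝕜 * Γ.Jtilde 𝕜 = 0 := by
  have h0 := Γ.σ_eq_zero (Nat.lt_succ_self (Fintype.card V - Γ.dim))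
  have h := Γ.Q_succ_add 𝕜 (Fintype.card V - Γ.dim)
  rw [Γ.Q_eq_zero_of_σ_eq_zero 𝕜 h0, h0] at h
  rw [Jtilde, J, Matrix.mul_smul]
  simpa using congrArg (((Γ.σ (Fintype.card V - Γ.dim) : 𝕜)⁻¹) • ·) h

theorem Jtilde_mul_laplacian : Γ.Jtilde 𝕜 * Γ.laplacian 𝕜 = 0 := by
  rw [← Γ.laplacian_mul_Jtilde 𝕜]
  exact (((Γ.commute_laplacian_Q 𝕜 _).smul_right _).eq).symm

theorem Q_mul_Jtilde (k : ℕ) : Γ.Q 𝕜 k * Γ.Jtilde 𝕜 = (Γ.σ k : 𝕜) • Γ.Jtilde 𝕜 := by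
  cases k with
  | zero => rw [Q_zero, Matrix.smul_mul, one_mul]
  | succ k =>
    rw [Q_succ, sub_mul, (Γ.commute_laplacian_Q 𝕜 k).eq, mul_assoc, laplacian_mul_Jtilde,
      mul_zero, sub_zero, Matrix.smul_mul, one_mul]

theorem Jtilde_mul_self : Γ.Jtilde 𝕜 * Γ.Jtilde 𝕜 = Γ.Jtilde 𝕜 := by
  conv_lhs => enter [1]; rw [Jtilde, J]
  rw [Matrix.smul_mul, Q_mul_Jtilde, inv_smul_smul₀ (Γ.σ_top_ne_zero 𝕜)]

/-- The difference of the two last normalized forest matrices, scaled to be the group inverse of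
the Laplacian matrix. -/
noncomputable def forestInverse : Matrix V V 𝕜 :=
  ((Γ.σ (Fintype.card V - Γ.dim - 1) : 𝕜) / (Γ.σ (Fintype.card V - Γ.dim) : 𝕜)) •
    (Γ.J 𝕜 (Fintype.card V - Γ.dim - 1) - Γ.Jtilde 𝕜)

theorem forestInverse_eq : Γ.forestInverse 𝕜 = (Γ.σ (Fintype.card V - Γ.dim) : 𝕜)⁻¹ •
    (Γ.Q 𝕜 (Fintype.card V - Γ.dim - 1) -
      (Γ.σ (Fintype.card V - Γ.dim - 1) : 𝕜) • Γ.Jtilde 𝕜) := by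
  rw [forestInverse, ← σ_smul_J, ← smul_sub, smul_smul, div_eq_inv_mul]

theorem forestInverse_mul_Jtilde : Γ.forestInverse 𝕜 * Γ.Jtilde 𝕜 = 0 := by
  rw [forestInverse_eq, Matrix.smul_mul, sub_mul, Matrix.smul_mul, Jtilde_mul_self, Q_mul_Jtilde,
    sub_self, smul_zero]

theorem commute_laplacian_forestInverse : Commute (Γ.laplacian 𝕜) (Γ.forestInverse 𝕜) := by
  rw [forestInverse_eq]
  refine ((Γ.commute_laplacian_Q 𝕜 _).sub_right (Commute.smul_right ?_ _)).smul_right _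
  rw [Commute, SemiconjBy, laplacian_mul_Jtilde, Jtilde_mul_laplacian]

theorem laplacian_mul_forestInverse :
    Γ.laplacian 𝕜 * Γ.forestInverse 𝕜 = 1 - Γ.Jtilde 𝕜 := by
  have hσ := Γ.σ_top_ne_zero 𝕜
  rw [forestInverse_eq, Matrix.mul_smul, mul_sub, Matrix.mul_smul, laplacian_mul_Jtilde, smul_zero,
    sub_zero]
  have hL := Γ.laplacian_mul_Jtilde 𝕜
  rw [inv_smul_eq_iff₀ hσ, smul_sub, Jtilde, σ_smul_J]
  rw [Jtilde, J, Matrix.mul_smul, smul_eq_zero_iff_right (inv_ne_zero hσ)] at hL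
  -- If `n - d = 0`, the truncated index `n - d - 1` is also `0`, and both sides vanish because `L
  -- Q_0 = 0`.
  rcases h : Fintype.card V - Γ.dim with _ | k
  · rw [h] at hL
    rw [Nat.zero_sub, hL, Q_zero, sub_self]
  · rw [Nat.add_sub_cancel, Q_succ, sub_sub_cancel]

theorem isGroupInverse_forestInverse :
    IsGroupInverse (Γ.laplacian 𝕜) (Γ.forestInverse 𝕜) := by
  have hc : Γ.laplacian 𝕜 * Γ.forestInverse 𝕜 = Γ.forestInverse 𝕜 * Γ.laplacian 𝕜 :=
    Γ.commute_laplacian_forestInverse 𝕜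
  refine ⟨?_, ?_, hc⟩
  · rw [laplacian_mul_forestInverse, sub_mul, Jtilde_mul_laplacian, one_mul, sub_zero]
  · rw [mul_assoc, laplacian_mul_forestInverse, mul_sub, forestInverse_mul_Jtilde, mul_one,
      sub_zero]

theorem Jtilde_mul_forestInverse : Γ.Jtilde 𝕜 * Γ.forestInverse 𝕜 = 0 := by
  obtain ⟨-, h, hc⟩ := Γ.isGroupInverse_forestInverse 𝕜
  rw [← h, ← hc, ← mul_assoc, ← mul_assoc, Jtilde_mul_laplacian, zero_mul, zero_mul]

theorem laplacian_add_smul_Jtilde_mul {α : 𝕜} (hα : α ≠ 0) :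
    (Γ.laplacian 𝕜 + α • Γ.Jtilde 𝕜) * (Γ.forestInverse 𝕜 + α⁻¹ • Γ.Jtilde 𝕜) = 1 := by
  rw [add_mul, mul_add, mul_add, laplacian_mul_forestInverse, Matrix.mul_smul,
    laplacian_mul_Jtilde, Matrix.smul_mul, Jtilde_mul_forestInverse, Matrix.smul_mul,
    Matrix.mul_smul, Jtilde_mul_self, smul_inv_smul₀ hα]
  simp

theorem inv_laplacian_add_smul_Jtilde {α : 𝕜} (hα : α ≠ 0) :
    (Γ.laplacian 𝕜 + α • Γ.Jtilde 𝕜)⁻¹ = Γ.forestInverse 𝕜 + α⁻¹ • Γ.Jtilde 𝕜 :=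
  Matrix.inv_eq_right_inv (Γ.laplacian_add_smul_Jtilde_mul 𝕜 hα)

theorem tendsto_inv_laplacian_add_smul_Jtilde :
    Tendsto (fun α : 𝕜 => (Γ.laplacian 𝕜 + α • Γ.Jtilde 𝕜)⁻¹)
      (comap (fun α : 𝕜 => ‖α‖) atTop) (𝓝 (Γ.forestInverse 𝕜)) := by
  rw [comap_norm_atTop]
  have h : Tendsto (fun α : 𝕜 => Γ.forestInverse 𝕜 + α⁻¹ • Γ.Jtilde 𝕜)
      (Bornology.cobounded 𝕜) (𝓝 (Γ.forestInverse 𝕜 + (0 : 𝕜) • Γ.Jtilde 𝕜)) :=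
    tendsto_const_nhds.add (tendsto_inv₀_cobounded.smul_const _)
  rw [zero_smul, add_zero] at h
  refine h.congr' ?_
  filter_upwards [Bornology.eventually_ne_cobounded (0 : 𝕜)] with α hα
  exact (Γ.inv_laplacian_add_smul_Jtilde 𝕜 hα).symm

/-! ### The resolvent identity and the limit in `τ` -/

/-- The coefficient of `τ ^ (k + 1)` is the recurrence; the excess term of degree `n - d + 1` is
zero since `L Q_{n-d} = 0`. -/
theorem QParam_add_smul (τ : ℝ) :
    Γ.QParam 𝕜 τ + (τ : 𝕜) • (Γ.QParam 𝕜 τ * Γ.laplacian 𝕜) = (Γ.σParam τ : 𝕜) • 1 := by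
  have hL : Γ.laplacian 𝕜 * Γ.Q 𝕜 (Fintype.card V - Γ.dim) = 0 := by
    rw [← σ_smul_J, Matrix.mul_smul]
    exact (congrArg _ (Γ.laplacian_mul_Jtilde 𝕜)).trans (smul_zero _)
  unfold QParam σParam
  rw [Finset.sum_mul, Finset.smul_sum, Finset.sum_range_succ', Finset.sum_range_succ (n := _ - _)]
  simp only [Matrix.smul_mul, ← (Γ.commute_laplacian_Q 𝕜 _).eq, hL, smul_zero, add_zero]
  rw [add_right_comm, ← Finset.sum_add_distrib, Finset.sum_range_succ']
  push_cast
  rw [add_smul, Finset.sum_smul, Q_zero]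
  congr 1
  · refine Finset.sum_congr rfl fun k _ => ?_
    rw [mul_comm, mul_smul, ← Q_succ_add, smul_add, smul_smul, pow_succ']
  · simp

theorem σParam_pos {τ : ℝ} (hτ : 0 < τ) : 0 < Γ.σParam τ := by
  refine Finset.sum_pos' (fun k _ => mul_nonneg ?_ (by positivity))
    ⟨Fintype.card V - Γ.dim, by simp, mul_pos Γ.σ_top_pos (by positivity)⟩
  exact Finset.sum_nonneg fun F hF => (Γ.weight_pos (Γ.inForestsWith_subset _ hF)).le

theorem JParam_add_smul {τ : ℝ} (hτ : 0 < τ) :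
    Γ.JParam 𝕜 τ + (τ : 𝕜) • (Γ.JParam 𝕜 τ * Γ.laplacian 𝕜) = 1 := by
  have hσ : (Γ.σParam τ : 𝕜) ≠ 0 := by exact_mod_cast (Γ.σParam_pos hτ).ne'
  rw [JParam, Matrix.smul_mul, smul_comm, ← smul_add, QParam_add_smul, inv_smul_smul₀ hσ]

/-- Multiply `τ J(τ) L = I - J(τ)` on the right by `forestInverse`, using `L X = I - J̃` and `J(τ)
J̃ = J̃`. -/
theorem smul_JParam_sub_Jtilde {τ : ℝ} (hτ : 0 < τ) :
    (τ : 𝕜) • (Γ.JParam 𝕜 τ - Γ.Jtilde 𝕜) =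
      (1 - Γ.JParam 𝕜 τ) * Γ.forestInverse 𝕜 := by
  have h := Γ.JParam_add_smul 𝕜 hτ
  have hJ : Γ.JParam 𝕜 τ * Γ.Jtilde 𝕜 = Γ.Jtilde 𝕜 := by
    have := congrArg (· * Γ.Jtilde 𝕜) h
    simpa only [add_mul, Matrix.smul_mul, mul_assoc, laplacian_mul_Jtilde, mul_zero, smul_zero,
      add_zero, one_mul] using this
  rw [← eq_sub_iff_add_eq'.2 h, Matrix.smul_mul, mul_assoc, laplacian_mul_forestInverse, mul_sub,
    mul_one, hJ]

end WeightedDigraph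

/-- A polynomial function divided by the power of its degree tends to the leading coefficient. -/
theorem tendsto_inv_pow_smul_sum {𝕜 E : Type*} [RCLike 𝕜] [AddCommGroup E] [Module 𝕜 E]
    [TopologicalSpace E] [ContinuousAdd E] [ContinuousSMul 𝕜 E] (m : ℕ) (c : ℕ → E) :
    Tendsto (fun τ : ℝ => ((τ : 𝕜) ^ m)⁻¹ • ∑ k ∈ Finset.range (m + 1), (τ : 𝕜) ^ k • c k)
      atTop (𝓝 (c m)) := by
  have hinv : Tendsto (fun τ : ℝ => (τ : 𝕜)⁻¹) atTop (𝓝 0) := by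
    have := (RCLike.continuous_ofReal (K := 𝕜)).tendsto 0 |>.comp tendsto_inv_atTop_zero
    simpa [Function.comp_def] using this
  have h : ∀ k ∈ Finset.range m,
      Tendsto (fun τ : ℝ => ((τ : 𝕜)⁻¹) ^ (m - k) • c k) atTop (𝓝 0) := by
    intro k hk
    have hk' : m - k ≠ 0 := by have := Finset.mem_range.1 hk; omega
    have := (hinv.pow (m - k)).smul_const (c k)
    rwa [zero_pow hk', zero_smul] at this
  have hs := (tendsto_finsetSum _ h).add_const (c m)
  rw [Finset.sum_const_zero, zero_add] at hs
  refine hs.congr' ?_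
  filter_upwards [eventually_gt_atTop 0] with τ hτ
  have hτ' : (τ : 𝕜) ≠ 0 := by exact_mod_cast hτ.ne'
  rw [Finset.sum_range_succ, smul_add, inv_smul_smul₀ (pow_ne_zero _ hτ'), Finset.smul_sum]
  congr 1
  refine Finset.sum_congr rfl fun k hk => ?_
  rw [smul_smul, inv_pow, pow_sub₀ _ hτ' (Finset.mem_range.1 hk).le, mul_inv, inv_inv]

namespace WeightedDigraph

variable {V : Type*} [Fintype V] [DecidableEq V] (𝕜 : Type*) [RCLike 𝕜] (Γ : WeightedDigraph V)

theorem tendsto_JParam : Tendsto (fun τ : ℝ => Γ.JParam 𝕜 τ) atTop (𝓝 (Γ.Jtilde 𝕜)) := by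
  have hQ := tendsto_inv_pow_smul_sum (𝕜 := 𝕜) (Fintype.card V - Γ.dim) (Γ.Q 𝕜)
  have hσ := tendsto_inv_pow_smul_sum (𝕜 := 𝕜) (Fintype.card V - Γ.dim)
    (fun k => (Γ.σ k : 𝕜))
  refine ((hσ.inv₀ (Γ.σ_top_ne_zero 𝕜)).smul hQ).congr' ?_
  filter_upwards [eventually_gt_atTop 0] with τ hτ
  have hτ' : (τ : 𝕜) ≠ 0 := by exact_mod_cast hτ.ne'
  have hs : (Γ.σParam τ : 𝕜) =
      ∑ k ∈ Finset.range (Fintype.card V - Γ.dim + 1), (τ : 𝕜) ^ k • (Γ.σ k : 𝕜) := by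
    unfold σParam
    push_cast
    exact Finset.sum_congr rfl fun k _ => mul_comm _ _
  rw [JParam, QParam, hs, smul_eq_mul, mul_inv, inv_inv, smul_smul, mul_right_comm,
    mul_inv_cancel₀ (pow_ne_zero _ hτ'), one_mul]

theorem tendsto_smul_JParam_sub_Jtilde :
    Tendsto (fun τ : ℝ => (τ : 𝕜) • (Γ.JParam 𝕜 τ - Γ.Jtilde 𝕜)) atTop
      (𝓝 (Γ.forestInverse 𝕜)) := by
  have h : Tendsto (fun τ : ℝ => (1 - Γ.JParam 𝕜 τ) * Γ.forestInverse 𝕜) atTop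
      (𝓝 ((1 - Γ.Jtilde 𝕜) * Γ.forestInverse 𝕜)) :=
    (tendsto_const_nhds.sub (Γ.tendsto_JParam 𝕜)).mul_const _
  rw [sub_mul, Jtilde_mul_forestInverse, one_mul, sub_zero] at h
  refine h.congr' ?_
  filter_upwards [eventually_gt_atTop 0] with τ hτ
  exact (Γ.smul_JParam_sub_Jtilde 𝕜 hτ).symm

end WeightedDigraph

theorem proposition15 {V : Type*} [Fintype V] [DecidableEq V] {𝕜 : Type*} [RCLike 𝕜]
    (Γ : WeightedDigraph V) :
    -- the group inverse of `L` exists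
    IsGroupInverse (Γ.laplacian 𝕜) (groupInverse (Γ.laplacian 𝕜)) ∧
    -- `J̃ = I - L L^#`
    Γ.Jtilde 𝕜 = 1 - Γ.laplacian 𝕜 * groupInverse (Γ.laplacian 𝕜) ∧
    -- (i)
    (∀ α : 𝕜, α ≠ 0 → IsUnit (Γ.laplacian 𝕜 + α • Γ.Jtilde 𝕜) ∧
      groupInverse (Γ.laplacian 𝕜) =
        (Γ.laplacian 𝕜 + α • Γ.Jtilde 𝕜)⁻¹ - α⁻¹ • Γ.Jtilde 𝕜) ∧
    Tendsto (fun α : 𝕜 => (Γ.laplacian 𝕜 + α • Γ.Jtilde 𝕜)⁻¹)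
      (comap (fun α : 𝕜 => ‖α‖) atTop) (𝓝 (groupInverse (Γ.laplacian 𝕜))) ∧
    -- (ii)
    (∀ α : 𝕜, α ≠ 0 → groupInverse (Γ.laplacian 𝕜) =
      (Γ.laplacian 𝕜 + α • Γ.Jtilde 𝕜)⁻¹ * (1 - Γ.Jtilde 𝕜)) ∧
    -- (iii)
    (Γ.dim < Fintype.card V → groupInverse (Γ.laplacian 𝕜) =
      ((Γ.σ (Fintype.card V - Γ.dim - 1) : 𝕜) / (Γ.σ (Fintype.card V - Γ.dim) : 𝕜)) •
        (Γ.J 𝕜 (Fintype.card V - Γ.dim - 1) - Γ.Jtilde 𝕜)) ∧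
    -- (iv)
    Tendsto (fun τ : ℝ => (τ : 𝕜) • (Γ.JParam 𝕜 τ - Γ.Jtilde 𝕜))
      atTop (𝓝 (groupInverse (Γ.laplacian 𝕜))) := by
  rw [(Γ.isGroupInverse_forestInverse 𝕜).groupInverse_eq]
  refine ⟨Γ.isGroupInverse_forestInverse 𝕜, ?_, fun α hα => ⟨?_, ?_⟩,
    Γ.tendsto_inv_laplacian_add_smul_Jtilde 𝕜, fun α hα => ?_, fun _ => rfl,
    Γ.tendsto_smul_JParam_sub_Jtilde 𝕜⟩
  · rw [Γ.laplacian_mul_forestInverse 𝕜, sub_sub_cancel]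
  · exact (Matrix.isUnit_iff_isUnit_det _).2
      (Matrix.isUnit_det_of_right_inverse (Γ.laplacian_add_smul_Jtilde_mul 𝕜 hα))
  · rw [Γ.inv_laplacian_add_smul_Jtilde 𝕜 hα, add_sub_cancel_right]
  · rw [Γ.inv_laplacian_add_smul_Jtilde 𝕜 hα, mul_sub, mul_one, add_mul,
      Γ.forestInverse_mul_Jtilde 𝕜, Matrix.smul_mul, Γ.Jtilde_mul_self 𝕜, zero_add,
      add_sub_cancel_right]
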